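/- Let $n$ be a natural number and $\mathcal{A}_n=\{1<\dots<n\}$. Let $\mathsf{styl}_n$ be the stylic monoid of rank $n$, i.e. the monoid generated by $\mathcal{A}_n$ subject to the relations $acb=cab$ for $a\le b<c$, $bac=bca$ for $a<b\le c$, and $a^2=a$, for $a,b,c\in\mathcal{A}_n$; write $[w]$ for the class of a word $w\in\mathcal{A}_n^*$. Let $\mathbb{T}=(\mathbb{R}\cup\{-\infty\},\max,+)$ be the tropical semifield and $U_{n+1}(\mathbb{T})$ the monoid of upper unitriangular $(n+1)\times(n+1)$ matrices over $\mathbb{T}$ (diagonal entries $0$, entries below the diagonal $-\infty$). For $x\in\mathcal{A}_n$ put $\overline{x}=n+1-x$, and likewise $\overline{i}=n+1-i$ for indices $1\le i\le n+1$. Let $\rho_n:\mathcal{A}_n^*\to U_{n+1}(\mathbb{T})$ be the monoid morphism with, for $x\in\mathcal{A}_n$, $$\rho_n(x)_{i,j}=\begin{cases}0&\text{if } i=j,\\ 1&\text{if } i\le\overline{x}<j,\\ -\infty&\text{otherwise.}\end{cases}$$ For $w\in\mathcal{A}_n^*$ let $N(w)$ be the $N$-tableau obtained by inserting the letters of $w$,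 from left to right, into the empty tableau by the right $N$-algorithm: to insert $a$ into a row $B$ (viewed as a set of letters), replace $B$ by $B\cup\{a\}$ and, if $B$ contains letters strictly greater than $a$, insert the smallest such letter (which also stays in its row) into the row above; the insertion of a letter of $w$ starts at the first (bottom) row. Theorem. The morphism $\rho_n$ induces a monoid morphism $\varrho_n:\mathsf{styl}_n\to U_{n+1}(\mathbb{T})$, $\varrho_n([w])=\rho_n(w)$, and $\varrho_n$ is injective, i.e. a faithful representation of $\mathsf{styl}_n$. Moreover, for every $w\in\mathcal{A}_n^*$: 1. For $1\le i<j\le n+1$ and every integer $k\ge1$, $\varrho_n([w])_{i,j}=k$ if and only if $k$ is the maximum length of a strictly decreasing subsequence of $w$ only using letters $a$ with $\overline{j}+1\le a\le\overline{i}$; and $\varrho_n([w])_{i,j}=-\infty$ if and only if $w$ contains no letter $a$ with $i\le\overline{a}<j$. 2. The tableau $N(w)$ can be recovered from $\varrho_n([w])$, i.e. it is a function of this matrix: for $a\in\mathcal{A}_n$ and $k\ge1$, the letter $a$ occurs in the $k$-th row of $N(w)$ if and only if there is $j\in\{1,\dots,n+1\}$ with $\overline{a}<j$, $\varrho_n([w])_{\overline{a},j}=k$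 and $\varrho_n([w])_{\overline{a}+1,j}=k-1$. Moreover, for $u,v\in\mathcal{A}_n^*$, $[u]=[v]$ if and only if $N(u)=N(v)$. -/

import Mathlib

namespace Stylic

/-! ### The max-plus tropical semifield -/

/-- The max-plus semifield `ℝ ∪ {-∞}`, with `max` as addition and `+` as multiplication.
Mathlib's `Tropical` is the min-convention, so the order of `ℝ` is reversed; the added top
element of `ℝᵒᵈ` is `-∞`. The lemmas below spell the operations out. -/
abbrev MaxPlus : Type := Tropical (WithTop ℝᵒᵈ)

/-- A real number as an element of the max-plus semifield. -/
def MaxPlus.ofReal (r : ℝ) : MaxPlus := Tropical.trop ((OrderDual.toDual r : ℝᵒᵈ) : WithTop ℝᵒᵈ)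

/-- The element `-∞` of the max-plus semifield. -/
def MaxPlus.negInf : MaxPlus := Tropical.trop (⊤ : WithTop ℝᵒᵈ)

theorem MaxPlus.negInf_eq_zero : MaxPlus.negInf = 0 := rfl

theorem MaxPlus.ofReal_zero_eq_one : MaxPlus.ofReal 0 = 1 := rfl

theorem MaxPlus.ofReal_injective : Function.Injective MaxPlus.ofReal := by
  intro a b h
  exact OrderDual.toDual.injective (WithTop.coe_injective (Tropical.trop_injective h))

theorem MaxPlus.ofReal_ne_negInf (a : ℝ) : MaxPlus.ofReal a ≠ MaxPlus.negInf := by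
  intro h
  exact WithTop.coe_ne_top (Tropical.trop_injective h)

theorem MaxPlus.eq_negInf_or_ofReal (x : MaxPlus) :
    x = MaxPlus.negInf ∨ ∃ a : ℝ, x = MaxPlus.ofReal a := by
  induction x using Tropical.tropRec with
  | h x =>
    cases x with
    | top => exact Or.inl rfl
    | coe a => exact Or.inr ⟨OrderDual.ofDual a, rfl⟩

theorem MaxPlus.ofReal_add_ofReal (a b : ℝ) :
    MaxPlus.ofReal a + MaxPlus.ofReal b = MaxPlus.ofReal (max a b) := by
  unfold MaxPlus.ofReal
  rw [← Tropical.trop_inf, ← WithTop.coe_inf, toDual_sup]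

theorem MaxPlus.ofReal_mul_ofReal (a b : ℝ) :
    MaxPlus.ofReal a * MaxPlus.ofReal b = MaxPlus.ofReal (a + b) := rfl

/-! ### Unitriangular matrices -/

/-- The monoid `U_m(S)` of upper unitriangular `m × m` matrices over a commutative semiring. -/
def unitriangular (m : ℕ) (S : Type*) [CommSemiring S] : Submonoid (Matrix (Fin m) (Fin m) S) where
  carrier := {M | (∀ i, M i i = 1) ∧ ∀ i j, j < i → M i j = 0}
  one_mem' := ⟨fun i => Matrix.one_apply_eq i, fun _ _ h => Matrix.one_apply_ne h.ne'⟩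
  mul_mem' := by
    rintro A B ⟨hA1, hA0⟩ ⟨hB1, hB0⟩
    refine ⟨fun i => ?_, fun i j hji => ?_⟩
    · rw [Matrix.mul_apply, Finset.sum_eq_single i]
      · rw [hA1, hB1, one_mul]
      · intro k _ hk
        rcases lt_or_gt_of_ne hk with h | h
        · rw [hA0 i k h, zero_mul]
        · rw [hB0 k i h, mul_zero]
      · intro h
        exact absurd (Finset.mem_univ i) h
    · rw [Matrix.mul_apply]
      refine Finset.sum_eq_zero fun k _ => ?_
      rcases lt_or_ge k i with h | h
      · rw [hA0 i k h, zero_mul]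
      · rw [hB0 k j (lt_of_lt_of_le hji h), mul_zero]

/-! ### Letters and indices

The alphabet `{1 < ⋯ < n}` is `Fin n` and the matrix index set `{1, …, n + 1}` is `Fin (n + 1)`;
`num` gives the number, counted from `1`, of a letter or of an index. -/

/-- The number, counted from `1`, of an element of `Fin m`. -/
def num {m : ℕ} (x : Fin m) : ℕ := (x : ℕ) + 1

/-- `bar x = n + 1 - x` for a letter `x` of the alphabet `{1, …, n}`. -/
def bar {n : ℕ} (x : Fin n) : ℕ := n + 1 - num x

/-- The matrix index in `{1, …, n + 1}` with number `bar a`. -/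
def barIndex {n : ℕ} (a : Fin n) : Fin (n + 1) := a.rev.castSucc

/-- The matrix index in `{1, …, n + 1}` with number `bar a + 1`. -/
def barIndexSucc {n : ℕ} (a : Fin n) : Fin (n + 1) := a.rev.succ

theorem num_barIndex {n : ℕ} (a : Fin n) : num (barIndex a) = bar a := by
  simp only [num, bar, barIndex, Fin.val_castSucc, Fin.val_rev]
  omega

theorem num_barIndexSucc {n : ℕ} (a : Fin n) : num (barIndexSucc a) = bar a + 1 := by
  simp only [num, bar, barIndexSucc, Fin.val_succ, Fin.val_rev]
  omega

/-! ### The stylic monoid -/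

/-- The stylic relations: the Knuth relations and the idempotency of the generators. -/
inductive Rel (n : ℕ) : FreeMonoid (Fin n) → FreeMonoid (Fin n) → Prop
  | knuth₁ (a b c : Fin n) (hab : a ≤ b) (hbc : b < c) :
      Rel n (FreeMonoid.of a * FreeMonoid.of c * FreeMonoid.of b)
        (FreeMonoid.of c * FreeMonoid.of a * FreeMonoid.of b)
  | knuth₂ (a b c : Fin n) (hab : a < b) (hbc : b ≤ c) :
      Rel n (FreeMonoid.of b * FreeMonoid.of a * FreeMonoid.of c)
        (FreeMonoid.of b * FreeMonoid.of c * FreeMonoid.of a)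
  | idem (a : Fin n) : Rel n (FreeMonoid.of a * FreeMonoid.of a) (FreeMonoid.of a)

/-- The stylic monoid of rank `n`. -/
abbrev Styl (n : ℕ) : Type := PresentedMonoid (Rel n)

/-- The stylic class of a word. -/
def cls {n : ℕ} : FreeMonoid (Fin n) →* Styl n := PresentedMonoid.mk (Rel n)

/-! ### The right N-algorithm -/

/-- The letter bumped when `a` is inserted into the row `B`: the smallest letter of `B` strictly
greater than `a`, if there is one. -/
def bump {n : ℕ} (a : Fin n) (B : Finset (Fin n)) : Option (Fin n) :=
  if h : (B.filter (fun b => a < b)).Nonempty then some ((B.filter (fun b => a < b)).min' h)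
  else none

/-- Right N-insertion of a letter into a tableau, given as the list of its rows, viewed as sets of
letters, from the bottom (first) row upwards. Bumped letters stay in their row. -/
def insertLetter {n : ℕ} : Fin n → List (Finset (Fin n)) → List (Finset (Fin n))
  | a, [] => [{a}]
  | a, B :: T =>
    insert a B ::
      (match bump a B with
        | none => T
        | some b => insertLetter b T)

/-- The N-tableau `N(w)` of a word: its letters are inserted one by one, from left to right, into
the empty tableau. -/
def nTableau {n : ℕ} (w : FreeMonoid (Fin n)) : List (Finset (Fin n)) :=
  w.toList.foldl (fun T a => insertLetter a T) []

/-- The `k`-th row, counted from `1` at the bottom, of a tableau (empty above the top row). -/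
def row {n : ℕ} (T : List (Finset (Fin n))) (k : ℕ) : Finset (Fin n) := T.getD (k - 1) ∅

/-! ### The representation of words -/

/-- The matrix of the letter `x`. -/
noncomputable def letterMatrix {n : ℕ} (x : Fin n) : Matrix (Fin (n + 1)) (Fin (n + 1)) MaxPlus :=
  Matrix.of fun i j =>
    if i = j then MaxPlus.ofReal 0
    else if num i ≤ bar x ∧ bar x < num j then MaxPlus.ofReal 1
    else MaxPlus.negInf

theorem letterMatrix_mem {n : ℕ} (x : Fin n) :
    letterMatrix x ∈ unitriangular (n + 1) MaxPlus := by
  refine ⟨fun i => ?_, fun i j hji => ?_⟩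
  · simp [letterMatrix, MaxPlus.ofReal_zero_eq_one]
  · have h : ¬ (num i ≤ bar x ∧ bar x < num j) := by
      have h' : (j : ℕ) < i := hji
      unfold num
      omega
    simp [letterMatrix, hji.ne', h, MaxPlus.negInf_eq_zero]

/-- The morphism `ρ_n` from words to unitriangular matrices that extends `letterMatrix`. -/
noncomputable def rho (n : ℕ) : FreeMonoid (Fin n) →* unitriangular (n + 1) MaxPlus :=
  FreeMonoid.lift fun x => ⟨letterMatrix x, letterMatrix_mem x⟩

/-- The lengths of the strictly decreasing subsequences of `w` that only use letters `a` with
`lo ≤ a ≤ hi`. -/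
def decLengths {n : ℕ} (w : FreeMonoid (Fin n)) (lo hi : ℕ) : Set ℕ :=
  {m | ∃ u : List (Fin n), List.Sublist u w.toList ∧ u.Pairwise (fun a b => a > b) ∧
    (∀ a ∈ u, lo ≤ num a ∧ num a ≤ hi) ∧ u.length = m}

end Stylic

/-! With letters counted from 0, let d(l, h) be the maximal length of a strictly decreasing
subsequence of w with letters in [l, h); this is `decMax`. Appending a letter x with l ≤ x < h
replaces d(l, h) by max (d(l, h), d(x+1, h) + 1). Max-plus multiplication by the matrix of x
performs the same update, so the entry (i, j) above the diagonal is d(n-j, n-i), with 0 written as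
-∞ (`rho_apply`, `isGreatest_decMax`).

The same table encodes N(w): a letter a lies in the row i, counted from 0, exactly when some d(l, ·)
with l ≤ a jumps from i to i + 1 at a (`mem_nTableau_iff`). The reason is the Monge inequality: the
increments of d(l, ·) can only grow with l. When x is appended, all d(l, ·) with l ≤ x are compared
with the single function s(h), equal to d(x+1, h) + 1 for h > x and to 0 otherwise. Its successive
jumps, the first at x, are the letters inserted into the successive rows: by Monge, each one is the
first jump of the row below after the previous one, which is the bumped letter.

Faithfulness follows from a cycle. Equal matrices give equal tables for h ≤ n, hence equal tableaux.
Equal tableaux give equal classes, because a word is congruent to the row reading of its tableau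
(`readingCls_nTableau`): this is Schensted insertion, with idempotency leaving a copy of the bumped
letter in its row. Equal classes give equal matrices, because the defining relations preserve the
table (`rho_eq_of_rel`). -/

namespace Stylic

/-! ### Lengths of decreasing subsequences in intervals of letters -/

/-- Update of the table of maximal lengths of decreasing subsequences with letters in `[l, h)`
when the letter `x` is appended to the word. -/
def decStep (d : ℕ → ℕ → ℕ) (x : ℕ) (l h : ℕ) : ℕ :=
  if l ≤ x ∧ x < h then max (d l h) (d (x + 1) h + 1) else d l h

/-- The maximal length of a strictly decreasing subsequence of `w` whose letters have values in
`[l, h)`. -/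
def decMax {n : ℕ} (w : List (Fin n)) : ℕ → ℕ → ℕ :=
  w.foldl (fun d (x : Fin n) => decStep d x) (fun _ _ => 0)

theorem decMax_nil {n : ℕ} (l h : ℕ) : decMax ([] : List (Fin n)) l h = 0 := rfl

theorem decMax_concat {n : ℕ} (w : List (Fin n)) (x : Fin n) :
    decMax (w ++ [x]) = decStep (decMax w) x := by
  simp [decMax, List.foldl_append]

/-- The properties of the table `decMax w`: it vanishes on empty intervals, is monotone and
`1`-Lipschitz in both arguments, and satisfies the Monge inequality. -/
structure IsMonge (d : ℕ → ℕ → ℕ) : Prop where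
  zero : ∀ {l h}, h ≤ l → d l h = 0
  anti : ∀ {l m} (h), l ≤ m → d m h ≤ d l h
  mono : ∀ (l) {h h'}, h ≤ h' → d l h ≤ d l h'
  left_lip : ∀ l h, d l h ≤ d (l + 1) h + 1
  right_lip : ∀ l h, d l (h + 1) ≤ d l h + 1
  monge : ∀ {l m h h'}, l ≤ m → m ≤ h → h ≤ h' → d l h' + d m h ≤ d l h + d m h'

/-- The five other properties feed the Monge inequality and the later jump arguments. Monge says
that the increment of d(l, ·) between h and h' is at most that of d(m, ·), so a jump persists when
the left end moves right. -/
theorem IsMonge.step {d : ℕ → ℕ → ℕ} (hd : IsMonge d) (x : ℕ) : IsMonge (decStep d x) where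
  zero {l h} hl := by
    rw [decStep, if_neg (by omega), hd.zero hl]
  anti {l m} h hl := by
    have h1 := hd.anti h hl
    simp only [decStep]
    by_cases hx : m ≤ x
    · split_ifs <;> omega
    · split_ifs <;> omega
  mono l {h h'} hh := by
    have h1 := hd.mono l hh
    have h2 := hd.mono (x + 1) hh
    simp only [decStep]
    split_ifs <;> omega
  left_lip l h := by
    have h1 := hd.left_lip l h
    simp only [decStep]
    -- Only for l = x does removing l from the interval remove x.
    rcases eq_or_ne l x with rfl | hx <;> split_ifs <;> omega
  right_lip l h := by
    have h1 := hd.right_lip l h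
    have h2 := hd.right_lip (x + 1) h
    have h3 := hd.zero (le_refl (x + 1))
    simp only [decStep]
    rcases eq_or_ne x h with rfl | hx <;> split_ifs <;> omega
  monge {l m h h'} hl hm hh := by
    have h1 := hd.monge hl hm hh
    have h2 := hd.anti h hl
    have h3 := hd.anti h' hl
    simp only [decStep]
    -- The position of x decides which entries are updated; when x lies between l and h, the old
    -- inequality is also needed with x + 1 as one of the left ends.
    rcases lt_or_ge x l with hx | hx
    · split_ifs <;> omega
    rcases lt_or_ge x m with hx' | hx'
    · have h4 := hd.monge (show x + 1 ≤ m from hx') hm hh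
      split_ifs <;> omega
    rcases lt_or_ge x h with hx'' | hx''
    · have h4 := hd.monge (show l ≤ x + 1 by omega) (show x + 1 ≤ h from hx'') hh
      split_ifs <;> omega
    · split_ifs <;> omega

theorem isMonge_decMax {n : ℕ} (w : List (Fin n)) : IsMonge (decMax w) := by
  induction w using List.reverseRecOn with
  | nil => constructor <;> intros <;> simp [decMax_nil]
  | append_singleton w x ih => rw [decMax_concat]; exact ih.step x

theorem decMax_eq_zero_iff {n : ℕ} (w : List (Fin n)) (l h : ℕ) :
    decMax w l h = 0 ↔ ∀ a ∈ w, ¬ (l ≤ (a : ℕ) ∧ (a : ℕ) < h) := by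
  induction w using List.reverseRecOn with
  | nil => simp [decMax_nil]
  | append_singleton w x ih =>
    rw [decMax_concat, decStep]
    split_ifs with hx
    · constructor
      · intro h0; omega
      · intro h0; exact absurd hx (h0 x (by simp))
    · rw [ih]
      constructor
      · intro h0 a ha
        rcases List.mem_append.1 ha with ha | ha
        · exact h0 a ha
        · rw [List.mem_singleton.1 ha]; exact hx
      · intro h0 a ha
        exact h0 a (List.mem_append_left _ ha)

/-- `decMax w l h` is the maximal length of a decreasing subsequence in `[l, h)`. -/
theorem isGreatest_decMax {n : ℕ} (w : List (Fin n)) (l h : ℕ) :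
    IsGreatest {m | ∃ u : List (Fin n), u.Sublist w ∧ u.Pairwise (fun a b => a > b) ∧
      (∀ a ∈ u, l ≤ (a : ℕ) ∧ (a : ℕ) < h) ∧ u.length = m} (decMax w l h) := by
  induction w using List.reverseRecOn generalizing l with
  | nil =>
    refine ⟨⟨[], by simp [decMax_nil]⟩, ?_⟩
    rintro m ⟨u, hu, -, -, rfl⟩
    rw [List.sublist_nil.1 hu]
    exact Nat.zero_le _
  | append_singleton w x ih =>
    rw [decMax_concat, decStep]
    have upper : ∀ m, (∃ u : List (Fin n), u.Sublist (w ++ [x]) ∧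
        u.Pairwise (fun a b => a > b) ∧ (∀ a ∈ u, l ≤ (a : ℕ) ∧ (a : ℕ) < h) ∧ u.length = m) →
        m ≤ decMax w l h ∨ (l ≤ (x : ℕ) ∧ (x : ℕ) < h ∧ m ≤ decMax w (x + 1) h + 1) := by
      rintro m ⟨u, hu, hp, hr, rfl⟩
      obtain ⟨u₁, u₂, rfl, h₁, h₂⟩ := List.sublist_append_iff.1 hu
      rcases List.sublist_singleton.1 h₂ with rfl | rfl
      · left
        rw [List.append_nil] at hp hr ⊢
        exact (ih l).2 ⟨u₁, h₁, hp, hr, rfl⟩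
      · right
        have hx := hr x (by simp)
        refine ⟨hx.1, hx.2, ?_⟩
        rw [List.pairwise_append] at hp
        have := (ih (x + 1)).2 ⟨u₁, h₁, hp.1, fun a ha => ⟨hp.2.2 a ha x (by simp),
          (hr a (List.mem_append_left _ ha)).2⟩, rfl⟩
        simpa using this
    have lower₁ := (ih l).1
    obtain ⟨u, hu, hp, hr, hlen⟩ := lower₁
    obtain ⟨v, hv, hvp, hvr, hvlen⟩ := (ih (x + 1)).1
    have hu' : u.Sublist (w ++ [x]) := hu.trans (List.sublist_append_left _ _)
    split_ifs with hx
    · constructor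
      · rcases le_total (decMax w l h) (decMax w (x + 1) h + 1) with hle | hle
        · rw [max_eq_right hle]
          refine ⟨v ++ [x], hv.append (List.Sublist.refl _), ?_, ?_, by simp [hvlen]⟩
          · rw [List.pairwise_append]
            refine ⟨hvp, List.pairwise_singleton _ _, fun a ha b hb => ?_⟩
            rw [List.mem_singleton.1 hb]
            exact (hvr a ha).1
          · intro a ha
            rcases List.mem_append.1 ha with ha | ha
            · have := hvr a ha
              omega
            · rw [List.mem_singleton.1 ha]; exact hx
        · rw [max_eq_left hle]
          exact ⟨u, hu', hp, hr, hlen⟩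
      · intro m hm
        rcases upper m hm with h1 | h1 <;> omega
    · exact ⟨⟨u, hu', hp, hr, hlen⟩, fun m hm => by rcases upper m hm with h1 | h1 <;> omega⟩

/-! ### The rows of the tableau and the jumps of `decMax` -/

/-- `a` is a position where some function `d l` with `l ≤ a` jumps from `k` to `k + 1`. -/
def IsJump (d : ℕ → ℕ → ℕ) (k a : ℕ) : Prop :=
  ∃ l ≤ a, d l a = k ∧ d l (a + 1) = k + 1

/-- The value with which the rows `l ≤ x` of the table are compared when `x` is appended. -/
def stepBound (d : ℕ → ℕ → ℕ) (x h : ℕ) : ℕ := if x < h then d (x + 1) h + 1 else 0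

/-- The bound no longer depends on l. Its default 0 for h ≤ x makes it rise from 0 to 1 at h = x,
since d(x+1, x+1) = 0, so insertion starts with x. -/
theorem decStep_eq (d : ℕ → ℕ → ℕ) (x l h : ℕ) :
    decStep d x l h = if l ≤ x then max (d l h) (stepBound d x h) else d l h := by
  simp only [decStep, stepBound]
  split_ifs <;> omega

theorem IsMonge.stepBound_mono {d : ℕ → ℕ → ℕ} (hd : IsMonge d) (x : ℕ) {h h' : ℕ}
    (hh : h ≤ h') : stepBound d x h ≤ stepBound d x h' := by
  have := hd.mono (x + 1) hh
  simp only [stepBound]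
  split_ifs <;> omega

theorem IsMonge.stepBound_succ_le {d : ℕ → ℕ → ℕ} (hd : IsMonge d) (x h : ℕ) :
    stepBound d x (h + 1) ≤ stepBound d x h + 1 := by
  have h1 := hd.right_lip (x + 1) h
  have h2 := hd.zero (le_refl (x + 1))
  simp only [stepBound]
  rcases eq_or_ne x h with rfl | hx <;> split_ifs <;> omega

/-- The row `k` gains exactly the letter inserted into it. -/
theorem IsMonge.isJump_decStep_iff {d : ℕ → ℕ → ℕ} (hd : IsMonge d) {x k c : ℕ}
    (hc : stepBound d x c = k) (hc' : stepBound d x (c + 1) = k + 1) (a : ℕ) :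
    IsJump (decStep d x) k a ↔ a = c ∨ IsJump d k a := by
  have hxc : x ≤ c := by
    by_contra hlt
    rw [stepBound, if_neg (by omega)] at hc'
    omega
  -- Take l = x: by `left_lip`, d(x, h) ≤ d(x+1, h) + 1, so beyond x the updated function for l = x
  -- is the step bound itself.
  have key : IsJump (decStep d x) k c := by
    refine ⟨x, hxc, ?_, ?_⟩ <;> simp only [decStep_eq, le_refl, if_true, hc, hc']
    · have h1 := hd.left_lip x c
      have h2 := hd.zero (l := x) (h := c)
      rw [stepBound] at hc
      split_ifs at hc <;> omega
    · have h1 := hd.left_lip x (c + 1)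
      rw [stepBound, if_pos (by omega)] at hc'
      omega
  constructor
  · rintro ⟨l, hl, h1, h2⟩
    rw [decStep_eq] at h1 h2
    by_cases hlx : l ≤ x
    · rw [if_pos hlx] at h1 h2
      rcases lt_trichotomy a c with hac | hac | hac
      · have h3 := hd.stepBound_mono x (show a + 1 ≤ c from hac)
        have h4 := hd.right_lip l a
        exact Or.inr ⟨l, hl, by omega, by omega⟩
      · exact Or.inl hac
      · have h3 := hd.stepBound_mono x (show c + 1 ≤ a from hac)
        omega
    · rw [if_neg hlx] at h1 h2
      exact Or.inr ⟨l, hl, h1, h2⟩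
  · rintro (rfl | ⟨l, hl, h1, h2⟩)
    · exact key
    · by_cases hlx : l ≤ x
      · rcases lt_trichotomy a c with hac | rfl | hac
        · have h3 := hd.stepBound_mono x (show a + 1 ≤ c from hac)
          have h4 := hd.stepBound_mono x (Nat.le_add_right a 1)
          refine ⟨l, hl, ?_, ?_⟩ <;> rw [decStep_eq, if_pos hlx] <;> omega
        · exact key
        -- The step bound may erase the jump for this l. The left end x + 1 is not updated, and
        -- Monge carries the jump at a over to it.
        · have h3 := hd.stepBound_mono x (show c + 1 ≤ a from hac)
          have h4 := hd.monge (show l ≤ x + 1 by omega) (show x + 1 ≤ a by omega) (Nat.le_add_right a 1)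
          have h5 := hd.anti (a + 1) (show l ≤ x + 1 by omega)
          have h6 : stepBound d x a = d (x + 1) a + 1 := if_pos (by omega)
          refine ⟨x + 1, by omega, ?_, ?_⟩ <;> rw [decStep_eq, if_neg (by omega)] <;> omega
      · refine ⟨l, hl, ?_, ?_⟩ <;> rw [decStep_eq, if_neg hlx] <;> assumption

/-- A jump of the step bound after `c` lies in the row `k`. -/
theorem isJump_of_stepBound {d : ℕ → ℕ → ℕ} {x k b : ℕ} (hxb : x < b)
    (hb : stepBound d x b = k + 1) (hb' : stepBound d x (b + 1) = k + 2) : IsJump d k b := by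
  rw [stepBound, if_pos (by omega)] at hb hb'
  exact ⟨x + 1, hxb, by omega, by omega⟩

/-- A monotone function with increments at most one takes each intermediate jump. -/
theorem exists_jump {f : ℕ → ℕ} (hf : ∀ m, f (m + 1) ≤ f m + 1) {c h k : ℕ} (hc : f c ≤ k)
    (hch : c ≤ h) (hh : k < f h) : ∃ b, c ≤ b ∧ b < h ∧ f b = k ∧ f (b + 1) = k + 1 := by
  induction h, hch using Nat.le_induction with
  | base => omega
  | succ h hch ih =>
    by_cases hk : k < f h
    · obtain ⟨b, h1, h2, h3⟩ := ih hk
      exact ⟨b, h1, by omega, h3⟩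
    · have := hf h
      exact ⟨h, hch, by omega, by omega, by omega⟩

/-- The step bound rises by unit steps, so beyond c it must pass from k + 1 to k + 2; that jump
belongs to d(x+1, ·), one level lower, hence to the row k. -/
theorem IsMonge.exists_isJump_lt {d : ℕ → ℕ → ℕ} (hd : IsMonge d) {x k c h : ℕ}
    (hc' : stepBound d x (c + 1) = k + 1) (hch : c < h) (hh : k + 1 < stepBound d x h) :
    ∃ b, c < b ∧ b < h ∧ IsJump d k b := by
  obtain ⟨b, h1, h2, h3, h4⟩ := exists_jump (hd.stepBound_succ_le x) hc'.le hch hh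
  have hxc : x ≤ c := by
    by_contra hlt
    rw [stepBound, if_neg (by omega)] at hc'
    omega
  exact ⟨b, h1, h2, isJump_of_stepBound (by omega) h3 h4⟩

/-- The first jump of the row `k` after `c` is the next jump of the step bound. -/
theorem IsMonge.stepBound_of_isJump {d : ℕ → ℕ → ℕ} (hd : IsMonge d) {x k c b : ℕ}
    (hc' : stepBound d x (c + 1) = k + 1) (hcb : c < b) (hb : IsJump d k b)
    (hmin : ∀ b', IsJump d k b' → c < b' → b ≤ b') :
    stepBound d x b = k + 1 ∧ stepBound d x (b + 1) = k + 2 := by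
  have hxc : x ≤ c := by
    by_contra hlt
    rw [stepBound, if_neg (by omega)] at hc'
    omega
  have h1 : stepBound d x b = k + 1 := by
    have h2 := hd.stepBound_mono x (show c + 1 ≤ b from hcb)
    by_contra hne
    obtain ⟨b', h3, h4, h5⟩ := hd.exists_isJump_lt hc' hcb (show k + 1 < stepBound d x b by omega)
    have := hmin b' h5 h3
    omega
  refine ⟨h1, ?_⟩
  obtain ⟨l, hl, h2, h3⟩ := hb
  have h4 := hd.right_lip (x + 1) b
  rw [stepBound, if_pos (by omega)] at h1 ⊢
  -- If l ≤ x + 1, Monge carries the jump to the left end x + 1; otherwise antitonicity in the left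
  -- end gives the required lower bound at b + 1.
  rcases le_total l (x + 1) with hlx | hlx
  · have h5 := hd.monge hlx (show x + 1 ≤ b by omega) (Nat.le_add_right b 1)
    omega
  · have h5 := hd.anti (b + 1) hlx
    omega

/-- The rows above the last one into which a letter is inserted do not change. -/
theorem IsMonge.isJump_decStep_iff_of_le {d : ℕ → ℕ → ℕ} (hd : IsMonge d) {x k a : ℕ}
    (hk : stepBound d x (a + 1) ≤ k) : IsJump (decStep d x) k a ↔ IsJump d k a := by
  have h0 := hd.stepBound_mono x (Nat.le_add_right a 1)
  constructor
  · rintro ⟨l, hl, h1, h2⟩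
    have h3 := hd.right_lip l a
    rw [decStep_eq] at h1 h2
    exact ⟨l, hl, by split_ifs at h1 h2 <;> omega, by split_ifs at h1 h2 <;> omega⟩
  · rintro ⟨l, hl, h1, h2⟩
    refine ⟨l, hl, ?_, ?_⟩ <;> rw [decStep_eq] <;> split_ifs <;> omega

/-- If the row `k` has no letter greater than the inserted letter `c`, the rows above do not
change. -/
theorem IsMonge.isJump_decStep_iff_of_forall_le {n : ℕ} {d : ℕ → ℕ → ℕ} (hd : IsMonge d)
    {x k c : ℕ} (hc' : stepBound d x (c + 1) = k + 1)
    (hb : ∀ b : Fin n, IsJump d k b → (b : ℕ) ≤ c) {j : ℕ} (hj : k < j) (a : Fin n) :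
    IsJump (decStep d x) j a ↔ IsJump d j a := by
  refine hd.isJump_decStep_iff_of_le (le_trans ?_ (Nat.succ_le_of_lt hj))
  by_contra hlt
  rcases le_or_gt (a : ℕ) c with hac | hac
  · have := hd.stepBound_mono x (show (a : ℕ) + 1 ≤ c + 1 by omega)
    omega
  · obtain ⟨b, h1, h2, h3⟩ := hd.exists_isJump_lt hc' (show c < a + 1 by omega) (not_le.1 hlt)
    have : b ≤ c := hb ⟨b, by omega⟩ h3
    omega

/-! ### Right N-insertion and the rows of the tableau. -/

theorem bump_eq_some {n : ℕ} {a b : Fin n} {B : Finset (Fin n)} (h : bump a B = some b) :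
    b ∈ B ∧ a < b ∧ ∀ c ∈ B, a < c → b ≤ c := by
  unfold bump at h
  split_ifs at h with hne
  obtain rfl := Option.some.inj h
  have := Finset.mem_filter.1 (Finset.min'_mem _ hne)
  exact ⟨this.1, this.2, fun c hc hac => Finset.min'_le _ _ (Finset.mem_filter.2 ⟨hc, hac⟩)⟩

theorem bump_eq_none {n : ℕ} {a : Fin n} {B : Finset (Fin n)} (h : bump a B = none) :
    ∀ c ∈ B, c ≤ a := by
  unfold bump at h
  split_ifs at h with hne
  intro c hc
  by_contra hac
  exact hne ⟨c, Finset.mem_filter.2 ⟨hc, not_le.1 hac⟩⟩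

/-- Insertion into the rows from the row `k` on, seen on jumps. -/
theorem IsMonge.mem_insertLetter {n : ℕ} {d : ℕ → ℕ → ℕ} (hd : IsMonge d) (x : ℕ)
    (T : List (Finset (Fin n))) (k : ℕ) (c : Fin n)
    (hT : ∀ i (a : Fin n), a ∈ T.getD i ∅ ↔ IsJump d (k + i) a)
    (hc : stepBound d x c = k) (hc' : stepBound d x (c + 1) = k + 1) (i : ℕ) (a : Fin n) :
    a ∈ (insertLetter c T).getD i ∅ ↔ IsJump (decStep d x) (k + i) a := by
  induction T generalizing k c i with
  | nil =>
    have hno : ∀ j, k ≤ j → ∀ b : Fin n, ¬ IsJump d j b := by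
      intro j hj b hb
      have := (hT (j - k) b).2 (by rwa [Nat.add_sub_cancel' hj])
      simp at this
    cases i with
    | zero =>
      rw [Nat.add_zero, hd.isJump_decStep_iff hc hc']
      simp [insertLetter, hno k le_rfl a, Fin.ext_iff]
    | succ i =>
      rw [hd.isJump_decStep_iff_of_forall_le hc' (fun b hb => absurd hb (hno k le_rfl b)) (by omega)]
      simp [insertLetter, hno (k + (i + 1)) (by omega) a]
  | cons B T ih =>
    have hB : ∀ b : Fin n, b ∈ B ↔ IsJump d k b := fun b => by simpa using hT 0 b
    have hT' : ∀ i (a : Fin n), a ∈ T.getD i ∅ ↔ IsJump d (k + 1 + i) a := fun i a => by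
      simpa [Nat.add_assoc, Nat.add_comm 1] using hT (i + 1) a
    cases i with
    | zero =>
      rw [Nat.add_zero, hd.isJump_decStep_iff hc hc']
      simp [insertLetter, hB, Fin.ext_iff]
    | succ i =>
      have hi : k + (i + 1) = k + 1 + i := by omega
      cases hbump : bump c B with
      | none =>
        rw [hd.isJump_decStep_iff_of_forall_le hc'
          (fun b hb => bump_eq_none hbump b ((hB b).2 hb)) (by omega), hi, ← hT']
        simp [insertLetter, hbump]
      | some b =>
        obtain ⟨h1, h2, h3⟩ := bump_eq_some hbump
        -- A jump is a natural number, perhaps not a letter; one below b would be a letter, against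
        -- the minimality of the bumped letter.
        have hn : ∀ b', IsJump d k b' → (c : ℕ) < b' → (b : ℕ) ≤ b' := by
          intro b' hb' hcb
          by_contra hlt
          have := b.2
          exact hlt (h3 ⟨b', by omega⟩ ((hB _).2 hb') hcb)
        obtain ⟨h4, h5⟩ := hd.stepBound_of_isJump hc' h2 ((hB b).1 h1) hn
        rw [hi, ← ih (k + 1) b hT' h4 h5 i]
        simp [insertLetter, hbump]

theorem nTableau_concat {n : ℕ} (w : List (Fin n)) (x : Fin n) :
    nTableau (FreeMonoid.ofList (w ++ [x])) = insertLetter x (nTableau (FreeMonoid.ofList w)) := by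
  simp [nTableau, List.foldl_append]

/-- The rows of the `N`-tableau are the jumps of `decMax`. -/
theorem mem_nTableau_iff {n : ℕ} (w : List (Fin n)) (i : ℕ) (a : Fin n) :
    a ∈ (nTableau (FreeMonoid.ofList w)).getD i ∅ ↔ IsJump (decMax w) i a := by
  induction w using List.reverseRecOn generalizing i a with
  | nil =>
    refine iff_of_false (Finset.notMem_empty a) ?_
    simp [IsJump, decMax_nil]
  | append_singleton w x ih =>
    have hd := isMonge_decMax w
    rw [nTableau_concat, decMax_concat]
    have := hd.mem_insertLetter x (nTableau (FreeMonoid.ofList w)) 0 x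
      (fun i a => by rw [Nat.zero_add]; exact ih i a) (by simp [stepBound])
      (by simp [stepBound, hd.zero le_rfl]) i a
    rwa [Nat.zero_add] at this

theorem insertLetter_nonempty {n : ℕ} (T : List (Finset (Fin n))) (a : Fin n)
    (hT : ∀ B ∈ T, B.Nonempty) : ∀ B ∈ insertLetter a T, B.Nonempty := by
  induction T generalizing a with
  | nil => simp [insertLetter]
  | cons C T ih =>
    have hT' : ∀ B ∈ T, B.Nonempty := fun B hB => hT B (List.mem_cons_of_mem _ hB)
    intro B hB
    rw [insertLetter, List.mem_cons] at hB
    rcases hB with rfl | hB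
    · exact Finset.insert_nonempty _ _
    · cases hb : bump a C with
      | none => rw [hb] at hB; exact hT' B hB
      | some b => rw [hb] at hB; exact ih b hT' B hB

theorem nTableau_nonempty {n : ℕ} (w : List (Fin n)) :
    ∀ B ∈ nTableau (FreeMonoid.ofList w), B.Nonempty := by
  induction w using List.reverseRecOn with
  | nil => intro B hB; exact absurd hB List.not_mem_nil
  | append_singleton w x ih => rw [nTableau_concat]; exact insertLetter_nonempty _ _ ih

/-- Past the end `getD` returns `∅`, so nonempty rows are what makes the number of rows visible. -/
theorem eq_of_getD_eq {α : Type*} {T T' : List (Finset α)} (hT : ∀ B ∈ T, B.Nonempty)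
    (hT' : ∀ B ∈ T', B.Nonempty) (h : ∀ i, T.getD i ∅ = T'.getD i ∅) : T = T' := by
  induction T generalizing T' with
  | nil =>
    cases T' with
    | nil => rfl
    | cons B T' =>
      have h0 : ∅ = B := by simpa using h 0
      exact absurd (hT' B List.mem_cons_self) (by simp [← h0])
  | cons C T ih =>
    cases T' with
    | nil =>
      have h0 : C = ∅ := by simpa using h 0
      exact absurd (hT C List.mem_cons_self) (by simp [h0])
    | cons B T' =>
      have h0 : C = B := by simpa using h 0
      rw [h0, ih (fun B hB => hT B (List.mem_cons_of_mem _ hB))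
        (fun B hB => hT' B (List.mem_cons_of_mem _ hB)) (fun i => by simpa using h (i + 1))]

/-- A jump at a letter a < n involves only the right ends a and a + 1, so h ≤ n suffices; the matrix
determines exactly this part of the table. -/
theorem nTableau_eq_of_decMax_eq {n : ℕ} (u v : List (Fin n))
    (h : ∀ l h, h ≤ n → decMax u l h = decMax v l h) :
    nTableau (FreeMonoid.ofList u) = nTableau (FreeMonoid.ofList v) := by
  refine eq_of_getD_eq (nTableau_nonempty u) (nTableau_nonempty v) fun i => ?_
  ext a
  rw [mem_nTableau_iff, mem_nTableau_iff, IsJump, IsJump]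
  have ha := a.2
  simp only [h _ _ ha.le, h _ _ (show (a : ℕ) + 1 ≤ n from ha)]

/-! ### The entries of the matrix of a word -/

theorem MaxPlus.negInf_mul (x : MaxPlus) : MaxPlus.negInf * x = MaxPlus.negInf := by
  rw [MaxPlus.negInf_eq_zero, zero_mul]

theorem MaxPlus.mul_negInf (x : MaxPlus) : x * MaxPlus.negInf = MaxPlus.negInf := by
  rw [MaxPlus.negInf_eq_zero, mul_zero]

/-- The order of `MaxPlus` reverses the usual one: -∞ is its greatest element, and a maximum in the
usual sense is a lower bound here. -/
theorem MaxPlus.le_negInf (x : MaxPlus) : x ≤ MaxPlus.negInf :=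
  Tropical.untrop_le_iff.1 le_top

theorem MaxPlus.ofReal_le_ofReal {a b : ℝ} (h : b ≤ a) : MaxPlus.ofReal a ≤ MaxPlus.ofReal b :=
  Tropical.untrop_le_iff.1 (WithTop.coe_le_coe.2 (OrderDual.toDual_le_toDual.2 h))

/-- A sum is equal to a summand that bounds all summands. -/
theorem MaxPlus.sum_eq {ι : Type*} [Fintype ι] (f : ι → MaxPlus) (i : ι)
    (h : ∀ k, f i ≤ f k) : ∑ k, f k = f i := by
  refine Tropical.untrop_injective ?_
  rw [Finset.untrop_sum']
  exact le_antisymm (Finset.inf_le (f := Tropical.untrop ∘ f) (Finset.mem_univ i))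
    (Finset.le_inf fun k _ => Tropical.untrop_le_iff.2 (h k))

theorem rho_concat_apply {n : ℕ} (w : List (Fin n)) (x : Fin n) (i j : Fin (n + 1)) :
    (rho n (FreeMonoid.ofList (w ++ [x]))).1 i j =
      ∑ k, (rho n (FreeMonoid.ofList w)).1 i k * letterMatrix x k j := by
  rw [FreeMonoid.ofList_append, map_mul, Submonoid.coe_mul, Matrix.mul_apply,
    FreeMonoid.ofList_singleton]
  rfl

/-- The entries above the diagonal of the matrix of a word. -/
theorem rho_apply {n : ℕ} (w : List (Fin n)) (i j : Fin (n + 1)) (hij : i < j) :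
    (rho n (FreeMonoid.ofList w)).1 i j =
      if decMax w (n - j) (n - i) = 0 then MaxPlus.negInf
      else MaxPlus.ofReal (decMax w (n - j) (n - i) : ℕ) := by
  induction w using List.reverseRecOn generalizing j with
  | nil =>
    rw [decMax_nil, if_pos rfl, FreeMonoid.ofList_nil, map_one, MaxPlus.negInf_eq_zero]
    exact Matrix.one_apply_ne hij.ne
  | append_singleton w x ih =>
    have hd := isMonge_decMax w
    have hij' : (i : ℕ) < j := hij
    have hj := j.2
    have hx := x.2
    set M := (rho n (FreeMonoid.ofList w)).1 with hM
    have hdiag : ∀ k, M k k = MaxPlus.ofReal 0 := (rho n (FreeMonoid.ofList w)).2.1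
    have hlow : ∀ a b, b < a → M a b = MaxPlus.negInf := (rho n (FreeMonoid.ofList w)).2.2
    have hLd : letterMatrix x j j = MaxPlus.ofReal 0 := if_pos rfl
    have hL1 : ∀ k : Fin (n + 1), (k : ℕ) + x + 1 ≤ n → n < j + x + 1 →
        letterMatrix x k j = MaxPlus.ofReal 1 := by
      intro k h1 h2
      have hk : k ≠ j := by rintro rfl; omega
      simp only [letterMatrix, Matrix.of_apply]
      rw [if_neg hk, if_pos]
      simp only [num, bar]
      omega
    have hL0 : ∀ k : Fin (n + 1), k ≠ j → ¬ ((k : ℕ) + x + 1 ≤ n ∧ n < j + x + 1) →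
        letterMatrix x k j = MaxPlus.negInf := by
      intro k hk h1
      simp only [letterMatrix, Matrix.of_apply]
      rw [if_neg hk, if_neg]
      simp only [num, bar]
      omega
    have hMj : M i j * letterMatrix x j j = M i j := by
      rw [hLd, MaxPlus.ofReal_zero_eq_one, mul_one]
    rw [rho_concat_apply, decMax_concat, decStep]
    by_cases hcase : n - (j : ℕ) ≤ x ∧ (x : ℕ) < n - i
    · rw [if_pos hcase, if_neg (by omega)]
      -- The index n - 1 - x is the largest k for which x contributes 1 in column j; its entry in
      -- row i has left end x + 1.
      have hp : n - (n - 1 - (x : ℕ)) = x + 1 := by omega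
      have bound : ∀ k, MaxPlus.ofReal ((max (decMax w (n - j) (n - i))
          (decMax w (x + 1) (n - i) + 1) : ℕ) : ℝ) ≤ M i k * letterMatrix x k j := by
        intro k
        rcases lt_or_ge k i with hki | hki
        · rw [hlow _ _ hki, MaxPlus.negInf_mul]; exact MaxPlus.le_negInf _
        rcases eq_or_ne k j with rfl | hkj
        · rw [hMj, ih _ hij]
          split_ifs
          · exact MaxPlus.le_negInf _
          · exact MaxPlus.ofReal_le_ofReal (Nat.cast_le.2 (le_max_left _ _))
        by_cases hk : (k : ℕ) + x + 1 ≤ n ∧ n < j + x + 1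
        · rw [hL1 k hk.1 hk.2]
          rcases eq_or_lt_of_le hki with rfl | hki
          · rw [hdiag, MaxPlus.ofReal_mul_ofReal]
            refine MaxPlus.ofReal_le_ofReal ?_
            rw [zero_add, ← Nat.cast_one, Nat.cast_le]
            omega
          · rw [ih _ hki]
            split_ifs
            · rw [MaxPlus.negInf_mul]; exact MaxPlus.le_negInf _
            · rw [MaxPlus.ofReal_mul_ofReal]
              refine MaxPlus.ofReal_le_ofReal ?_
              rw [← Nat.cast_succ, Nat.cast_le]
              have := hd.anti (n - i) (show (x : ℕ) + 1 ≤ n - k by omega)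
              omega
        · rw [hL0 k hkj hk, MaxPlus.mul_negInf]; exact MaxPlus.le_negInf _
      suffices h : ∃ k, M i k * letterMatrix x k j = MaxPlus.ofReal
          ((max (decMax w (n - j) (n - i)) (decMax w (x + 1) (n - i) + 1) : ℕ) : ℝ) by
        obtain ⟨k, hk⟩ := h
        rw [← hk]
        exact MaxPlus.sum_eq (fun k => M i k * letterMatrix x k j) k (fun k' => hk ▸ bound k')
      rcases le_or_gt (decMax w (x + 1) (n - i) + 1) (decMax w (n - j) (n - i)) with hle | hle
      · refine ⟨j, ?_⟩
        rw [hMj, ih _ hij, max_eq_left hle, if_neg (by omega)]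
      · rw [max_eq_right hle.le]
        -- A zero length is stored as -∞ off the diagonal, so the value 1 must come from the
        -- diagonal summand k = i.
        by_cases h0 : decMax w (x + 1) (n - i) = 0
        · refine ⟨i, ?_⟩
          rw [hdiag, hL1 i (by omega) (by omega), h0, MaxPlus.ofReal_mul_ofReal]
          norm_num
        · have hne : (i : ℕ) < n - 1 - x := by
            by_contra hge
            exact h0 (hd.zero (by omega))
          refine ⟨⟨n - 1 - x, by omega⟩, ?_⟩
          rw [ih _ hne]
          simp only [hp]
          rw [if_neg h0, hL1 _ (by simp only; omega) (by omega), MaxPlus.ofReal_mul_ofReal,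
            Nat.cast_add, Nat.cast_one]
    -- Here, among the indices k ≥ i, only the diagonal entry of column j of the letter matrix is
    -- finite.
    · rw [if_neg hcase, ← ih _ hij, ← hMj]
      refine MaxPlus.sum_eq (fun k => M i k * letterMatrix x k j) j fun k => ?_
      rcases eq_or_ne k j with rfl | hkj
      · exact le_rfl
      rcases lt_or_ge k i with hki | hki
      · simp only [hlow _ _ hki, MaxPlus.negInf_mul]; exact MaxPlus.le_negInf _
      · have hki' : (i : ℕ) ≤ k := hki
        simp only [hL0 k hkj (by omega), MaxPlus.mul_negInf]; exact MaxPlus.le_negInf _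

theorem rho_eq_ofReal_iff {n : ℕ} (w : List (Fin n)) {i j : Fin (n + 1)} (hij : i < j) {k : ℕ}
    (hk : 1 ≤ k) : (rho n (FreeMonoid.ofList w)).1 i j = MaxPlus.ofReal (k : ℝ) ↔
      decMax w (n - j) (n - i) = k := by
  rw [rho_apply w i j hij]
  split_ifs with h
  · exact iff_of_false (MaxPlus.ofReal_ne_negInf _).symm (by omega)
  · rw [MaxPlus.ofReal_injective.eq_iff, Nat.cast_inj]

theorem rho_eq_negInf_iff {n : ℕ} (w : List (Fin n)) {i j : Fin (n + 1)} (hij : i < j) :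
    (rho n (FreeMonoid.ofList w)).1 i j = MaxPlus.negInf ↔ decMax w (n - j) (n - i) = 0 := by
  rw [rho_apply w i j hij]
  split_ifs with h
  · simp [h]
  · exact iff_of_false (MaxPlus.ofReal_ne_negInf _) h

theorem rho_eq_of_decMax_eq {n : ℕ} (u v : List (Fin n)) (h : decMax u = decMax v) :
    rho n (FreeMonoid.ofList u) = rho n (FreeMonoid.ofList v) := by
  refine Subtype.ext (Matrix.ext fun i j => ?_)
  rcases lt_trichotomy i j with hij | rfl | hij
  · rw [rho_apply u i j hij, rho_apply v i j hij, h]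
  · rw [(rho n (FreeMonoid.ofList u)).2.1, (rho n (FreeMonoid.ofList v)).2.1]
  · rw [(rho n (FreeMonoid.ofList u)).2.2 i j hij, (rho n (FreeMonoid.ofList v)).2.2 i j hij]

theorem decMax_eq_of_rho_eq {n : ℕ} (u v : List (Fin n))
    (h : rho n (FreeMonoid.ofList u) = rho n (FreeMonoid.ofList v)) (l k : ℕ) (hk : k ≤ n) :
    decMax u l k = decMax v l k := by
  rcases le_or_gt k l with hl | hl
  · rw [(isMonge_decMax u).zero hl, (isMonge_decMax v).zero hl]
  have hi : n - (n - k) = k := by omega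
  have hj : n - (n - l) = l := by omega
  have hij : (⟨n - k, by omega⟩ : Fin (n + 1)) < ⟨n - l, by omega⟩ := by
    rw [Fin.mk_lt_mk]; omega
  have key := congrArg (fun M => M.1 ⟨n - k, by omega⟩ ⟨n - l, by omega⟩) h
  by_cases h0 : decMax u l k = 0
  · rw [(rho_eq_negInf_iff u hij).2 (by simpa only [hi, hj] using h0)] at key
    have := (rho_eq_negInf_iff v hij).1 key.symm
    simp only [hi, hj] at this
    omega
  · have h1 := (rho_eq_ofReal_iff u hij (Nat.pos_of_ne_zero h0)).2 (by simp only [hi, hj])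
    have := (rho_eq_ofReal_iff v hij (Nat.pos_of_ne_zero h0)).1 (key.symm.trans h1)
    simp only [hi, hj] at this
    omega

/-- The matrices respect the stylic relations. -/
theorem rho_eq_of_rel {n : ℕ} {u v : FreeMonoid (Fin n)} (h : Rel n u v) :
    rho n u = rho n v := by
  induction h with
  | knuth₁ a b c hab hbc =>
    refine rho_eq_of_decMax_eq [a, c, b] [c, a, b] ?_
    have hab' : (a : ℕ) ≤ b := hab
    have hbc' : (b : ℕ) < c := hbc
    funext l h
    simp only [decMax, List.foldl, decStep]
    split_ifs <;> omega
  | knuth₂ a b c hab hbc =>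
    refine rho_eq_of_decMax_eq [b, a, c] [b, c, a] ?_
    have hab' : (a : ℕ) < b := hab
    have hbc' : (b : ℕ) ≤ c := hbc
    funext l h
    simp only [decMax, List.foldl, decStep]
    split_ifs <;> omega
  | idem a =>
    refine rho_eq_of_decMax_eq [a, a] [a] ?_
    funext l h
    simp only [decMax, List.foldl, decStep]
    split_ifs <;> omega

/-- The morphism from the stylic monoid induced by `rho`. -/
noncomputable def stylRho (n : ℕ) : Styl n →* unitriangular (n + 1) MaxPlus :=
  PresentedMonoid.lift
    (fun x => (⟨letterMatrix x, letterMatrix_mem x⟩ : unitriangular (n + 1) MaxPlus))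
    (fun a b (h : Rel n a b) => rho_eq_of_rel h)

theorem stylRho_cls {n : ℕ} (w : FreeMonoid (Fin n)) : stylRho n (cls w) = rho n w := rfl

/-! ### The row reading of a tableau -/

/-- The class of the word of a list of letters. -/
def clsList {n : ℕ} (L : List (Fin n)) : Styl n := cls (FreeMonoid.ofList L)

theorem clsList_append {n : ℕ} (L L' : List (Fin n)) :
    clsList (L ++ L') = clsList L * clsList L' := by
  rw [clsList, FreeMonoid.ofList_append, map_mul]; rfl

theorem clsList_cons {n : ℕ} (a : Fin n) (L : List (Fin n)) :
    clsList (a :: L) = clsList [a] * clsList L := clsList_append [a] L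

theorem cls_eq_of_rel {n : ℕ} {u v : FreeMonoid (Fin n)} (h : Rel n u v) : cls u = cls v :=
  PresentedMonoid.mk_eq_mk_of_rel h

theorem clsList_knuth₁ {n : ℕ} {a b c : Fin n} (hab : a ≤ b) (hbc : b < c) :
    clsList [a, c, b] = clsList [c, a, b] := cls_eq_of_rel (Rel.knuth₁ a b c hab hbc)

theorem clsList_knuth₂ {n : ℕ} {a b c : Fin n} (hab : a < b) (hbc : b ≤ c) :
    clsList [b, a, c] = clsList [b, c, a] := cls_eq_of_rel (Rel.knuth₂ a b c hab hbc)

theorem clsList_idem {n : ℕ} (a : Fin n) : clsList [a, a] = clsList [a] :=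
  cls_eq_of_rel (Rel.idem a)

/-- A letter moves to the left through a row of larger letters. -/
theorem clsList_larger {n : ℕ} {x : Fin n} (b : Fin n) (L : List (Fin n))
    (hs : (b :: L).Pairwise (· ≤ ·)) (hx : x < b) :
    clsList (b :: (L ++ [x])) = clsList (b :: x :: L) := by
  induction L generalizing b with
  | nil => rfl
  | cons z L ih =>
    have hbz : b ≤ z := (List.pairwise_cons.1 hs).1 z List.mem_cons_self
    rw [List.cons_append, clsList_cons, ih z (List.pairwise_cons.1 hs).2 (hx.trans_le hbz),
      ← clsList_cons]
    change clsList ([b, z, x] ++ L) = clsList ([b, x, z] ++ L)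
    rw [clsList_append, clsList_append, clsList_knuth₂ hx hbz]

/-- A letter moves to the left through a row of smaller letters followed by a smaller letter. -/
theorem clsList_smaller {n : ℕ} {x b : Fin n} (L : List (Fin n))
    (hs : (L ++ [x]).Pairwise (· ≤ ·)) (hx : x < b) :
    clsList (L ++ [b, x]) = clsList (b :: (L ++ [x])) := by
  induction L with
  | nil => rfl
  | cons y L ih =>
    have hs' := List.pairwise_cons.1 hs
    rw [List.cons_append, clsList_cons, ih hs'.2, ← clsList_cons]
    -- The Knuth move y b z = b y z needs a witness z right of b with y ≤ z < b: the first letter of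
    -- `L ++ [x]`.
    obtain ⟨z, L', hz⟩ : ∃ z L', L ++ [x] = z :: L' := by
      cases L with
      | nil => exact ⟨x, [], rfl⟩
      | cons z L => exact ⟨z, L ++ [x], rfl⟩
    have hyz : y ≤ z := hs'.1 z (by change z ∈ L ++ [x]; rw [hz]; exact List.mem_cons_self)
    have hzb : z < b := by
      have hzm : z ∈ L ++ [x] := by rw [hz]; exact List.mem_cons_self
      rcases List.mem_append.1 hzm with h | h
      · exact lt_of_le_of_lt ((List.pairwise_append.1 hs'.2).2.2 z h x (by simp)) hx
      · rw [List.mem_singleton.1 h]; exact hx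
    rw [List.cons_append, hz]
    change clsList ([y, b, z] ++ L') = clsList ([b, y, z] ++ L')
    rw [clsList_append, clsList_append, clsList_knuth₁ hyz hzb]

/-- The class of the increasing word of a row. -/
def rowCls {n : ℕ} (B : Finset (Fin n)) : Styl n := clsList (B.sort (· ≤ ·))

theorem sort_eq_of_pairwise {n : ℕ} {B : Finset (Fin n)} {L : List (Fin n)}
    (hL : L.Pairwise (· < ·)) (hB : ∀ a, a ∈ L ↔ a ∈ B) : B.sort (· ≤ ·) = L := by
  have hLB : L.toFinset = B := by ext a; simp [hB]
  rw [← hLB]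
  exact (List.toFinset_sort (· ≤ ·) (hL.imp fun h => h.ne)).2 (hL.imp fun h => h.le)

/-- A row and the result of inserting `x` into it, cut at `x`. -/
theorem exists_sort_eq {n : ℕ} (x : Fin n) (B : Finset (Fin n)) :
    ∃ L₀ L₁ : List (Fin n), (L₀ ++ [x] ++ L₁).Pairwise (· < ·) ∧
      (∀ a, a ∈ L₁ ↔ a ∈ B ∧ x < a) ∧ (insert x B).sort (· ≤ ·) = L₀ ++ [x] ++ L₁ ∧
      (B.sort (· ≤ ·) = L₀ ++ [x] ++ L₁ ∨ B.sort (· ≤ ·) = L₀ ++ L₁) := by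
  have hp : (((B.filter (· < x)).sort (· ≤ ·)) ++ [x] ++
      ((B.filter (x < ·)).sort (· ≤ ·))).Pairwise (· < ·) := by
    simp only [List.pairwise_append, List.mem_append, Finset.mem_sort, Finset.mem_filter,
      List.mem_singleton]
    refine ⟨⟨Finset.sortedLT_sort _ |>.pairwise, List.pairwise_singleton _ _, ?_⟩,
      Finset.sortedLT_sort _ |>.pairwise, ?_⟩
    · rintro a ⟨-, ha⟩ b rfl
      exact ha
    · rintro a (⟨-, ha⟩ | rfl) b ⟨-, hb⟩
      · exact ha.trans hb
      · exact hb
  refine ⟨_, _, hp, by simp, sort_eq_of_pairwise hp fun a => ?_, ?_⟩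
  · simp only [List.mem_append, Finset.mem_sort, Finset.mem_filter, List.mem_singleton,
      Finset.mem_insert]
    rcases lt_trichotomy a x with h | rfl | h
    · simp [h, h.ne, h.not_gt]
    · simp
    · simp [h, h.ne', h.not_gt]
  · by_cases hx : x ∈ B
    · left
      refine sort_eq_of_pairwise hp fun a => ?_
      simp only [List.mem_append, Finset.mem_sort, Finset.mem_filter, List.mem_singleton]
      rcases lt_trichotomy a x with h | rfl | h
      · simp [h, h.ne, h.not_gt]
      · simp [hx]
      · simp [h, h.ne', h.not_gt]
    · right
      refine sort_eq_of_pairwise (hp.sublist ?_) fun a => ?_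
      · exact (List.sublist_append_left _ _).append (List.Sublist.refl _)
      simp only [List.mem_append, Finset.mem_sort, Finset.mem_filter]
      rcases lt_trichotomy a x with h | rfl | h
      · simp [h, h.not_gt]
      · simp [hx]
      · simp [h, h.not_gt]

/-- Insertion into a row as an identity in the stylic monoid. -/
theorem rowCls_mul {n : ℕ} (B : Finset (Fin n)) (x : Fin n) :
    rowCls B * clsList [x] =
      (match bump x B with
        | none => 1
        | some b => clsList [b]) * rowCls (insert x B) := by
  obtain ⟨L₀, L₁, hp, hL₁, hins, hB⟩ := exists_sort_eq x B
  have hp' : (L₀ ++ [x] ++ L₁).Pairwise (· ≤ ·) := hp.imp fun h => h.le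
  rw [List.pairwise_append] at hp'
  have absorb : ∀ L, L = L₀ ++ [x] ∨ L = L₀ → clsList (L ++ [x]) = clsList (L₀ ++ [x]) := by
    rintro L (rfl | rfl)
    · rw [List.append_assoc, clsList_append, List.singleton_append, clsList_idem, ← clsList_append]
    · rfl
  obtain ⟨L, hL, hBL⟩ : ∃ L, (L = L₀ ++ [x] ∨ L = L₀) ∧ B.sort (· ≤ ·) = L ++ L₁ := by
    rcases hB with hB | hB
    · exact ⟨_, Or.inl rfl, hB⟩
    · exact ⟨_, Or.inr rfl, hB⟩
  have hLx : (L ++ [x]).Pairwise (· ≤ ·) := by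
    rcases hL with rfl | rfl
    · rw [List.pairwise_append]
      refine ⟨hp'.1, List.pairwise_singleton _ _, fun a ha b hb => ?_⟩
      rw [List.mem_singleton.1 hb]
      rcases List.mem_append.1 ha with h | h
      · exact (List.pairwise_append.1 hp'.1).2.2 a h x (by simp)
      · exact (List.mem_singleton.1 h).le
    · exact hp'.1
  rw [rowCls, rowCls, hins, hBL, ← clsList_append]
  cases hb : bump x B with
  | none =>
    have : L₁ = [] := List.eq_nil_iff_forall_not_mem.2 fun a ha =>
      not_lt.2 (bump_eq_none hb a ((hL₁ a).1 ha).1) ((hL₁ a).1 ha).2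
    rw [this, List.append_nil, List.append_nil, one_mul, absorb L hL]
  | some b =>
    obtain ⟨h1, h2, h3⟩ := bump_eq_some hb
    have hbm : b ∈ L₁ := (hL₁ b).2 ⟨h1, h2⟩
    cases L₁ with
    | nil => exact absurd hbm List.not_mem_nil
    | cons c R =>
      obtain rfl : c = b := by
        have hc := (hL₁ c).1 List.mem_cons_self
        refine le_antisymm ?_ (h3 c hc.1 hc.2)
        rcases List.mem_cons.1 hbm with h | h
        · exact h.ge
        · exact (List.pairwise_cons.1 hp'.2.1).1 b h
      have hs : (c :: c :: R).Pairwise (· ≤ ·) := by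
        refine List.pairwise_cons.2 ⟨fun a ha => ?_, hp'.2.1⟩
        rcases List.mem_cons.1 ha with h | h
        · exact h.ge
        · exact (List.pairwise_cons.1 hp'.2.1).1 a h
      calc clsList (L ++ c :: R ++ [x])
          = clsList L * (clsList [c] * clsList (R ++ [x])) := by
            rw [List.append_assoc, clsList_append, List.cons_append, clsList_cons]
        -- Idempotency doubles the bumped letter: one copy leaves to the left, the other stays in
        -- the row.
        _ = clsList L * clsList (c :: (c :: R ++ [x])) := by
            rw [← clsList_idem c, ← clsList_append]; rfl
        _ = clsList L * clsList (c :: x :: c :: R) := by rw [clsList_larger c (c :: R) hs h2]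
        _ = clsList (L ++ [c, x]) * clsList (c :: R) := by
            rw [← clsList_append, ← clsList_append, List.append_assoc]; rfl
        _ = clsList [c] * clsList (L₀ ++ [x]) * clsList (c :: R) := by
            rw [clsList_smaller L hLx h2, clsList_cons, absorb L hL]
        _ = clsList [c] * clsList (L₀ ++ [x] ++ c :: R) := by
            rw [clsList_append (L₀ ++ [x]), mul_assoc]

/-- The class of the row reading of a tableau, from the top row to the bottom row. -/
def readingCls {n : ℕ} : List (Finset (Fin n)) → Styl n
  | [] => 1
  | B :: T => readingCls T * rowCls B

/-- By `rowCls_mul` the bumped letter comes out on the left of its row, thus just after the reading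
of the rows above, where it is inserted next. -/
theorem readingCls_insertLetter {n : ℕ} (T : List (Finset (Fin n))) (x : Fin n) :
    readingCls (insertLetter x T) = readingCls T * clsList [x] := by
  induction T generalizing x with
  | nil => simp [insertLetter, readingCls, rowCls]
  | cons B T ih =>
    rw [readingCls, mul_assoc, rowCls_mul, insertLetter, readingCls]
    cases bump x B with
    | none => simp only [one_mul]
    | some b => simp only [ih, mul_assoc]

/-- A word is congruent to the row reading of its `N`-tableau. -/
theorem readingCls_nTableau {n : ℕ} (w : List (Fin n)) :
    readingCls (nTableau (FreeMonoid.ofList w)) = cls (FreeMonoid.ofList w) := by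
  induction w using List.reverseRecOn with
  | nil => rfl
  | append_singleton w x ih =>
    rw [nTableau_concat, readingCls_insertLetter, ih]
    exact (clsList_append w [x]).symm

/-! ### Faithfulness, and reading the tableau off the matrix. -/

theorem rho_eq_rho_iff {n : ℕ} (u v : FreeMonoid (Fin n)) :
    (rho n u = rho n v ↔ cls u = cls v) ∧ (cls u = cls v ↔ nTableau u = nTableau v) := by
  have h1 : rho n u = rho n v → nTableau u = nTableau v := fun h =>
    nTableau_eq_of_decMax_eq u.toList v.toList (decMax_eq_of_rho_eq u.toList v.toList h)
  have h2 : nTableau u = nTableau v → cls u = cls v := fun h => by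
    have hu := readingCls_nTableau u.toList
    have hv := readingCls_nTableau v.toList
    rw [FreeMonoid.ofList_toList] at hu hv
    rw [← hu, ← hv, h]
  have h3 : cls u = cls v → rho n u = rho n v := fun h => by
    rw [← stylRho_cls, ← stylRho_cls, h]
  exact ⟨⟨h2 ∘ h1, h3⟩, ⟨h1 ∘ h3, h2⟩⟩

/-- The closed interval of letters counted from 1 becomes the half-open interval [n - j, n - i) of
letters counted from 0. -/
theorem isGreatest_decLengths {n : ℕ} (w : FreeMonoid (Fin n)) {i j : Fin (n + 1)} :
    IsGreatest (decLengths w (n + 1 - num j + 1) (n + 1 - num i))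
      (decMax w.toList (n - j) (n - i)) := by
  convert isGreatest_decMax w.toList (n - j) (n - i) using 1
  ext m
  simp only [decLengths, num, Set.mem_ofPred_eq]
  refine exists_congr fun u => and_congr_right fun _ => and_congr_right fun _ =>
    and_congr_left fun _ => forall₂_congr fun a _ => ?_
  omega

/-- The rows of the `N`-tableau in terms of the matrix. -/
theorem mem_row_iff {n : ℕ} (w : FreeMonoid (Fin n)) (a : Fin n) {k : ℕ} (hk : 1 ≤ k) :
    a ∈ row (nTableau w) k ↔
      ∃ j : Fin (n + 1), bar a < num j ∧
        (rho n w).1 (barIndex a) j = MaxPlus.ofReal (k : ℝ) ∧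
        (rho n w).1 (barIndexSucc a) j = MaxPlus.ofReal ((k : ℝ) - 1) := by
  obtain ⟨i, rfl⟩ : ∃ i, k = i + 1 := ⟨k - 1, by omega⟩
  have ha := a.2
  have hd := isMonge_decMax w.toList
  have hb0 : ((barIndex a : Fin (n + 1)) : ℕ) = n - (a + 1) := by simp [barIndex]
  have hb1 : ((barIndexSucc a : Fin (n + 1)) : ℕ) = n - a := by
    simp only [barIndexSucc, Fin.val_succ, Fin.val_rev]; omega
  have hn0 : n - (n - ((a : ℕ) + 1)) = a + 1 := by omega
  have hn1 : n - (n - (a : ℕ)) = a := by omega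
  have e0 : ∀ {j : Fin (n + 1)}, barIndex a < j →
      ((rho n w).1 (barIndex a) j = MaxPlus.ofReal ((i + 1 : ℕ) : ℝ) ↔
        decMax w.toList (n - j) (a + 1) = i + 1) := by
    intro j hj
    have := rho_eq_ofReal_iff w.toList hj hk
    rwa [hb0, hn0, FreeMonoid.ofList_toList] at this
  have e1 : ∀ {j : Fin (n + 1)}, barIndexSucc a < j → 1 ≤ i →
      ((rho n w).1 (barIndexSucc a) j = MaxPlus.ofReal (i : ℝ) ↔
        decMax w.toList (n - j) a = i) := by
    intro j hj hi
    have := rho_eq_ofReal_iff w.toList hj hi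
    rwa [hb1, hn1, FreeMonoid.ofList_toList] at this
  have diag : (rho n w).1 (barIndexSucc a) (barIndexSucc a) = MaxPlus.ofReal 0 :=
    (rho n w).2.1 _
  have hcast : ((i + 1 : ℕ) : ℝ) - 1 = (i : ℝ) := by push_cast; ring
  have hmem := mem_nTableau_iff w.toList i a
  rw [FreeMonoid.ofList_toList] at hmem
  rw [row, Nat.add_sub_cancel, hmem, hcast]
  have hlt : barIndex a < barIndexSucc a := by rw [Fin.lt_def, hb0, hb1]; omega
  constructor
  · rintro ⟨l, hl, h1, h2⟩
    -- In the bottom row the matrix must show the real number 0, which occurs only on the diagonal;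
    -- this forces the column `barIndexSucc a`. Higher rows use the column n - l of the jump.
    rcases Nat.eq_zero_or_pos i with rfl | hi
    · refine ⟨barIndexSucc a, by rw [num_barIndexSucc]; omega, (e0 hlt).2 ?_, by simpa using diag⟩
      rw [hb1, hn1]
      -- If a did not occur in w, then [l, a + 1) would contain no letter of w, since [l, a)
      -- contains none.
      by_contra hne
      have h3 := hd.left_lip a (a + 1)
      have h4 := hd.zero (le_refl ((a : ℕ) + 1))
      have h5 : decMax w.toList a (a + 1) = 0 := by omega
      rw [decMax_eq_zero_iff] at h1 h5
      have h6 : decMax w.toList l (a + 1) = 0 := by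
        rw [decMax_eq_zero_iff]
        intro b hb hlb
        have := h1 b hb
        have := h5 b hb
        omega
      omega
    · have hla : l < a := by
        by_contra hge
        rw [hd.zero (not_lt.1 hge)] at h1
        omega
      have hj : n - (n - l) = l := by omega
      refine ⟨⟨n - l, by omega⟩, ?_, ?_, ?_⟩
      · simp only [bar, num]; omega
      · rw [e0 (by rw [Fin.lt_def, hb0]; simp only; omega)]
        simpa only [hj] using h2
      · rw [e1 (by rw [Fin.lt_def, hb1]; simp only; omega) hi]
        simpa only [hj] using h1
  · rintro ⟨j, hj, h1, h2⟩
    have hj2 := j.2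
    simp only [bar, num] at hj
    rw [e0 (by rw [Fin.lt_def, hb0]; omega)] at h1
    refine ⟨n - j, by omega, ?_, h1⟩
    -- On the diagonal the entry 0 matches the empty interval [a, a), so only the bottom row can
    -- arise.
    rcases eq_or_ne (barIndexSucc a) j with rfl | hne
    · rw [diag, MaxPlus.ofReal_injective.eq_iff] at h2
      have : i = 0 := by exact_mod_cast h2.symm
      rw [hb1, hn1, hd.zero le_rfl, this]
    · have hlt' : barIndexSucc a < j := by
        refine lt_of_le_of_ne ?_ hne
        rw [Fin.le_def, hb1]
        omega
      rcases Nat.eq_zero_or_pos i with rfl | hi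
      · have := rho_apply w.toList _ _ hlt'
        rw [FreeMonoid.ofList_toList, h2, hb1, hn1] at this
        split_ifs at this with h0
        · exact h0
        · exact (Nat.cast_injective (MaxPlus.ofReal_injective this)).symm
      · exact (e1 hlt' hi).1 h2

end Stylic

theorem mainTheorem2 (n : ℕ) :
    ∃ ϱ : Stylic.Styl n →* Stylic.unitriangular (n + 1) Stylic.MaxPlus,
      -- `ϱ` is the morphism induced by `ρ_n`
      (∀ w : FreeMonoid (Fin n), ϱ (Stylic.cls w) = Stylic.rho n w) ∧
      -- it is faithful
      Function.Injective ϱ ∧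
      -- its entries above the diagonal
      (∀ (w : FreeMonoid (Fin n)) (i j : Fin (n + 1)), i < j →
        (∀ k : ℕ, 1 ≤ k →
          ((ϱ (Stylic.cls w)).1 i j = Stylic.MaxPlus.ofReal (k : ℝ) ↔
            IsGreatest
              (Stylic.decLengths w (n + 1 - Stylic.num j + 1) (n + 1 - Stylic.num i)) k)) ∧
        ((ϱ (Stylic.cls w)).1 i j = Stylic.MaxPlus.negInf ↔
          ∀ a ∈ w.toList, ¬ (Stylic.num i ≤ Stylic.bar a ∧ Stylic.bar a < Stylic.num j))) ∧
      -- the rows of the N-tableau of a word are read off from its image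
      (∀ (w : FreeMonoid (Fin n)) (a : Fin n) (k : ℕ), 1 ≤ k →
        (a ∈ Stylic.row (Stylic.nTableau w) k ↔
          ∃ j : Fin (n + 1), Stylic.bar a < Stylic.num j ∧
            (ϱ (Stylic.cls w)).1 (Stylic.barIndex a) j = Stylic.MaxPlus.ofReal (k : ℝ) ∧
            (ϱ (Stylic.cls w)).1 (Stylic.barIndexSucc a) j =
              Stylic.MaxPlus.ofReal ((k : ℝ) - 1))) ∧
      -- the N-tableau is a function of the image, and separates stylic classes
      (∃ R : Stylic.unitriangular (n + 1) Stylic.MaxPlus → List (Finset (Fin n)),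
        ∀ w : FreeMonoid (Fin n), R (ϱ (Stylic.cls w)) = Stylic.nTableau w) ∧
      (∀ u v : FreeMonoid (Fin n),
        Stylic.cls u = Stylic.cls v ↔ Stylic.nTableau u = Stylic.nTableau v) := by
  have inj : Function.Injective (Stylic.stylRho n) := by
    intro x y
    obtain ⟨u, rfl⟩ := PresentedMonoid.surjective_mk x
    obtain ⟨v, rfl⟩ := PresentedMonoid.surjective_mk y
    exact (Stylic.rho_eq_rho_iff u v).1.1
  refine ⟨Stylic.stylRho n, Stylic.stylRho_cls, inj, fun w i j hij => ⟨fun k hk => ?_, ?_⟩,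
    fun w a k hk => Stylic.mem_row_iff w a hk, ?_, fun u v => (Stylic.rho_eq_rho_iff u v).2⟩
  · have hg := Stylic.isGreatest_decLengths w (i := i) (j := j)
    exact (Stylic.rho_eq_ofReal_iff w.toList hij hk).trans
      ⟨fun h => h ▸ hg, fun h => hg.unique h⟩
  · refine (Stylic.rho_eq_negInf_iff w.toList hij).trans
      ((Stylic.decMax_eq_zero_iff _ _ _).trans (forall₂_congr fun a _ => not_congr ?_))
    have ha := a.2
    have hi := i.2
    have hj := j.2
    simp only [Stylic.num, Stylic.bar]
    omega
  · have hR : Function.FactorsThrough (Stylic.nTableau (n := n))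
        (fun w => Stylic.stylRho n (Stylic.cls w)) := fun u v h =>
      (Stylic.rho_eq_rho_iff u v).2.1 (inj h)
    -- Off the image of the representation the value `[]` is arbitrary.
    exact ⟨Function.extend (fun w => Stylic.stylRho n (Stylic.cls w)) Stylic.nTableau fun _ => [],
      fun w => hR.extend_apply _ w⟩
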